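/- Let $d,n\ge 1$ be integers, $p\in[1,\infty)$, $1/q=1-1/p$, and $k\in\{1,\dots,d\}$. Let $\mathcal P_{k,p}=(\Theta,\mathcal Z,f)$ be the stochastic convex optimization problem with $$\Theta=\{\theta\in\mathbb R^d:\|\theta\|_\infty\le d^{-1/p}\},\qquad \mathcal Z=\{z\in\{0,\pm1\}^d: z\text{ has exactly }k\text{ nonzero coordinates}\},\qquad f(\theta,z)=-k^{-1/q}\langle\theta,z\rangle .$$ For $\alpha>0$, an $\alpha$-learner with $n$ samples for $(\Theta,\mathcal Z,f)$ is a randomized map $\mathcal A$ from $\mathcal Z^n$ to probability measures on $\Theta$ such that for every probability measure $\mathcal D$ on $\mathcal Z$, writing $F_{\mathcal D}(\theta)=\mathbb E_{Z\sim\mathcal D}f(\theta,Z)$, $$\mathbb E_{S\sim\mathcal D^{\otimes n},\ \hat\theta\sim\mathcal A(S)}\big[F_{\mathcal D}(\hat\theta)\big]-\inf_{\theta\in\Theta}F_{\mathcal D}(\theta)\le\alpha .$$ Theorem. There is a universal constant $c>0$ such that for all integers $d,n\ge1$, all $p\in[1,\infty)$ and all $\alpha>0$ the following hold. (i) If $p\in[1,2]$,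 $k=d$, and there exists an $\alpha$-learner with $n$ samples for $\mathcal P_{k,p}$, then $\alpha\ge c/\sqrt n$. (ii) If $p\in[2,\infty)$, $k=\min\{d,\max\{\lceil(6\alpha)^p d\rceil,1\}\}$, and there exists an $\alpha$-learner with $n$ samples for $\mathcal P_{k,p}$, then $$\alpha\ge c\,\min\Big\{\frac1{n^{1/p}},\ \frac{d^{1/2-1/p}}{\sqrt n}\Big\}.$$ -/

import Mathlib

open MeasureTheory ProbabilityTheory

noncomputable section

/-- Population risk `F_D(θ) = E_{Z ∼ D} f(θ, Z)` of a stochastic optimization problem with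
parameter space `Θ`, data space `Z` and loss `f`. -/
def populationRisk {Θ Z : Type*} [MeasurableSpace Z] (f : Θ → Z → ℝ) (D : Measure Z) (θ : Θ) : ℝ :=
  ∫ z, f θ z ∂D

/-- A (randomized) learner `A : Z^n → P(Θ)` is an `α`-learner for the problem `(Θ, Z, f)` if for
every probability measure `D` on `Z`, with an i.i.d. sample `S ∼ D^{⊗ n}` and output `θ̂ ∼ A(S)`,
the expected excess risk `E[F_D(θ̂)] - inf_θ F_D(θ)` is at most `α`.
(For a bounded measurable loss and nonempty `Θ`, as in the problems below, all the integrals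
and the infimum are genuine.) -/
def IsAlphaLearner {Θ Z : Type*} [MeasurableSpace Θ] [MeasurableSpace Z] (f : Θ → Z → ℝ)
    (α : ℝ) {n : ℕ} (A : Kernel (Fin n → Z) Θ) : Prop :=
  IsMarkovKernel A ∧
    ∀ D : Measure Z, IsProbabilityMeasure D →
      (∫ S, ∫ θ, populationRisk f D θ ∂(A S) ∂(Measure.pi fun _ : Fin n => D))
        - ⨅ θ : Θ, populationRisk f D θ ≤ α

/-- The parameter space of `P_{k,p}`: the `ℓ_∞` ball of radius `d^{-1/p}` in `ℝ^d`
(the norm of `Fin d → ℝ` is the sup norm). -/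
def hardParam (d : ℕ) (p : ℝ) : Set (Fin d → ℝ) :=
  Metric.closedBall 0 ((d : ℝ) ^ (-(1 / p)))

/-- The data space of `P_{k,p}`: the vectors in `{0, 1, -1}^d` with exactly `k` nonzero entries. -/
def hardData (d k : ℕ) : Set (Fin d → ℝ) :=
  {z | (∀ i, z i = 0 ∨ z i = 1 ∨ z i = -1) ∧ {i | z i ≠ 0}.ncard = k}

/-- The loss of `P_{k,p}`: `f(θ, z) = -k^{-1/q} ⟨θ, z⟩`, where `1/q = 1 - 1/p`. -/
def hardLoss (d k : ℕ) (p : ℝ) (θ : hardParam d p) (z : hardData d k) : ℝ :=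
  -((k : ℝ) ^ (-(1 - 1 / p)) * ∑ i, (θ : Fin d → ℝ) i * (z : Fin d → ℝ) i)

/-- The sparsity `k = (6α)^p d ∨ 1`, rounded up to an integer, and kept in `{1, …, d}`
(the cap at `d` is only active for `α > 1/6`). -/
def hardSparsity (d : ℕ) (p α : ℝ) : ℕ :=
  min d (max ⌈(6 * α) ^ p * (d : ℝ)⌉₊ 1)

end

/-! Cut `m * k ≤ d` coordinates into `m` disjoint blocks of size `k`. An example picks a block
uniformly and shows a sign there, with bias `τ` towards a hidden sign `v j`. The risk is linear, so
the excess risk is `K * τ` times the average sign error over the blocks, with `K = (k / d) ^ (1 /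
p)`.

Flipping one `v j` alters only the examples landing in block `j`, so the Bhattacharyya coefficient
of the two laws is at least `1 - τ ^ 2 / m` per sample. Assouad's averaging over `v` then gives `K *
(τ / 2 * (1 - 2 * n * τ ^ 2 / m)) ≤ α` (`IsAlphaLearner.le_of_blocks`, `hardLearner_le`).

The dense bound is `m = 1`. In the sparse case `k` is chosen so that `K ≥ 6 * α`; a learner of
accuracy `α` then needs more than `m / 4` samples, which bounds `α` below through `m ≈ d / k`. -/

/-- The real sign `±1` encoded by a Boolean. -/
noncomputable def boolSign (b : Bool) : ℝ := if b then 1 else -1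

theorem boolSign_mul_self (b : Bool) : boolSign b * boolSign b = 1 := by
  cases b <;> norm_num [boolSign]

theorem boolSign_not (b : Bool) : boolSign (!b) = -boolSign b := by
  cases b <;> norm_num [boolSign]

theorem abs_boolSign (b : Bool) : |boolSign b| = 1 := by
  cases b <;> norm_num [boolSign]

/-! ### Biased signs on random blocks -/

/-- The weights of the distribution on `Fin m × Bool` that picks a block uniformly and then a sign
with bias `τ` towards the sign prescribed by `v` for this block. -/
noncomputable def biasedWeight {m : ℕ} (τ : ℝ) (v : Fin m → Bool) (ω : Fin m × Bool) : ℝ :=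
  (1 + τ * (boolSign (v ω.1) * boolSign ω.2)) / (2 * m)

theorem biasedWeight_nonneg {m : ℕ} {τ : ℝ} (h0 : 0 ≤ τ) (h1 : τ ≤ 1) (v : Fin m → Bool)
    (ω : Fin m × Bool) : 0 ≤ biasedWeight τ v ω := by
  unfold biasedWeight
  apply div_nonneg _ (by positivity)
  cases v ω.1 <;> cases ω.2 <;> norm_num [boolSign] <;> linarith

theorem sum_biasedWeight_mul_sign {m : ℕ} (τ : ℝ) (v : Fin m → Bool) (a : Fin m → ℝ) :
    ∑ ω : Fin m × Bool, biasedWeight τ v ω * (boolSign ω.2 * a ω.1)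
      = τ / m * ∑ j, boolSign (v j) * a j := by
  rw [Fintype.sum_prod_type, Finset.mul_sum]
  refine Finset.sum_congr rfl fun j _ => ?_
  have hm : (m : ℝ) ≠ 0 := by
    have := j.pos
    positivity
  cases hv : v j <;> simp [biasedWeight, boolSign, hv] <;> field_simp <;> ring

theorem sum_biasedWeight {m : ℕ} (hm : 1 ≤ m) (τ : ℝ) (v : Fin m → Bool) :
    ∑ ω, biasedWeight τ v ω = 1 := by
  have hm : (m : ℝ) ≠ 0 := by positivity
  rw [Fintype.sum_prod_type]
  have : ∀ j : Fin m, ∑ b, biasedWeight τ v (j, b) = 1 / m := fun j => by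
    simp [biasedWeight, boolSign]
    field_simp
    ring
  rw [Finset.sum_congr rfl fun j _ => this j]
  simp [hm]

/-! ### Two-point testing and Assouad's lemma -/

/-- The Bhattacharyya coefficient bounds the testing affinity from below. -/
theorem sq_sum_le_two_mul_sum_min {ι : Type*} [Fintype ι] {P Q R : ι → ℝ}
    (hP : ∀ i, 0 ≤ P i) (hQ : ∀ i, 0 ≤ Q i) (hP1 : ∑ i, P i = 1) (hQ1 : ∑ i, Q i = 1)
    (hR : ∀ i, R i ^ 2 ≤ P i * Q i) :
    (∑ i, R i) ^ 2 ≤ 2 * ∑ i, min (P i) (Q i) := by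
  have hmin : ∀ i, 0 ≤ min (P i) (Q i) := fun i => le_min (hP i) (hQ i)
  have hmax : ∀ i, 0 ≤ max (P i) (Q i) := fun i => (hP i).trans (le_max_left _ _)
  have h1 : (∑ i, R i) ^ 2 ≤ (∑ i, min (P i) (Q i)) * ∑ i, max (P i) (Q i) :=
    Finset.sum_sq_le_sum_mul_sum_of_sq_le_mul _ (fun i _ => hmin i) (fun i _ => hmax i)
      fun i _ => by rw [min_mul_max]; exact hR i
  have h2 : ∑ i, max (P i) (Q i) ≤ 2 := by
    calc ∑ i, max (P i) (Q i) ≤ ∑ i, (P i + Q i) :=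
          Finset.sum_le_sum fun i _ => max_le_add_of_nonneg (hP i) (hQ i)
      _ = 2 := by rw [Finset.sum_add_distrib, hP1, hQ1]; norm_num
  have h3 : 0 ≤ ∑ i, min (P i) (Q i) := Finset.sum_nonneg fun i _ => hmin i
  nlinarith

/-- Testing a single coordinate of `v` against its flip. -/
theorem two_point_bound {m n : ℕ} (hm : 1 ≤ m) {τ : ℝ} (h0 : 0 ≤ τ) (h1 : τ ≤ 1)
    (v : Fin m → Bool) (j : Fin m) (g : (Fin n → Fin m × Bool) → ℝ) (hg : ∀ S, |g S| ≤ 1) :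
    1 - 2 * n * τ ^ 2 / m ≤
      ∑ S, (∏ i, biasedWeight τ v (S i)) * (1 - boolSign (v j) * g S) +
      ∑ S, (∏ i, biasedWeight τ (Function.update v j (!v j)) (S i)) *
        (1 - boolSign (!v j) * g S) := by
  set v' := Function.update v j (!v j) with hv'
  have hm0 : (0 : ℝ) < m := by positivity
  have hm1 : (1 : ℝ) ≤ m := by exact_mod_cast hm
  -- A lower bound for the root of the product of the two weights: on block `j` the root is `√(1 - τ
  -- ^ 2) / (2 * m)`, and `1 - τ ^ 2 ≤ √(1 - τ ^ 2)`.
  set r : Fin m × Bool → ℝ := fun ω =>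
    if ω.1 = j then (1 - τ ^ 2) / (2 * m) else biasedWeight τ v ω with hr
  have hτ : 0 ≤ 1 - τ ^ 2 := by nlinarith
  have hr2 : ∀ ω, r ω ^ 2 ≤ biasedWeight τ v ω * biasedWeight τ v' ω := by
    rintro ⟨i, b⟩
    by_cases hij : i = j
    · subst hij
      have e : biasedWeight τ v (i, b) * biasedWeight τ v' (i, b)
          = (1 - τ ^ 2) / (2 * m) ^ 2 := by
        simp only [biasedWeight, hv', Function.update_self, boolSign_not]
        have e1 := boolSign_mul_self (v i)
        have e2 := boolSign_mul_self b
        rw [div_mul_div_comm, ← sq]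
        congr 1
        linear_combination (-τ ^ 2 * boolSign b * boolSign b) * e1 - τ ^ 2 * e2
      rw [e]
      simp only [hr, if_true, div_pow]
      gcongr
      nlinarith
    · have e : biasedWeight τ v' (i, b) = biasedWeight τ v (i, b) := by
        simp [biasedWeight, hv', Function.update_of_ne hij]
      simp [hr, hij, e, sq]
  have hrs : ∑ ω, r ω = 1 - τ ^ 2 / m := by
    have e : ∀ ω, r ω = biasedWeight τ v ω -
        (if ω.1 = j then biasedWeight τ v ω - (1 - τ ^ 2) / (2 * m) else 0) := by
      intro ω
      by_cases h : ω.1 = j <;> simp [hr, h]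
    rw [Finset.sum_congr rfl fun ω _ => e ω, Finset.sum_sub_distrib, sum_biasedWeight hm,
      Fintype.sum_prod_type, Finset.sum_eq_single j]
    · simp [biasedWeight, boolSign]
      field_simp
      ring
    · intro i _ hij
      simp [hij]
    · simp
  have hPn : ∀ u : Fin m → Bool, ∀ S : Fin n → Fin m × Bool,
      0 ≤ ∏ i, biasedWeight τ u (S i) := fun u S =>
    Finset.prod_nonneg fun i _ => biasedWeight_nonneg h0 h1 u _
  have hP1 : ∀ u : Fin m → Bool, ∑ S : Fin n → Fin m × Bool, ∏ i, biasedWeight τ u (S i) = 1 :=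
    fun u => by rw [← Fintype.sum_pow, sum_biasedWeight hm, one_pow]
  have key := sq_sum_le_two_mul_sum_min (R := fun S : Fin n → Fin m × Bool => ∏ i, r (S i))
    (hPn v) (hPn v') (hP1 v) (hP1 v') fun S => by
      rw [← Finset.prod_pow, ← Finset.prod_mul_distrib]
      exact Finset.prod_le_prod (fun i _ => sq_nonneg _) fun i _ => hr2 _
  rw [← Fintype.sum_pow, hrs, ← pow_mul] at key
  have hb : 1 - 2 * n * τ ^ 2 / m ≤ (1 - τ ^ 2 / m) ^ (n * 2) := by
    have hx : τ ^ 2 / m ≤ 1 := by rw [div_le_one hm0]; nlinarith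
    have := one_add_mul_le_pow (a := -(τ ^ 2 / m)) (by linarith) (n * 2)
    rw [← sub_eq_add_neg] at this
    refine le_trans (le_of_eq ?_) this
    push_cast
    ring
  refine (hb.trans key).trans ?_
  rw [Finset.mul_sum, ← Finset.sum_add_distrib]
  -- Pointwise, `2 * min x y ≤ x * (1 - s) + y * (1 + s)` whenever `|s| ≤ 1`.
  refine Finset.sum_le_sum fun S _ => ?_
  set x := ∏ i, biasedWeight τ v (S i)
  set y := ∏ i, biasedWeight τ v' (S i)
  have hx : 0 ≤ x := hPn v S
  have hmx := min_le_left x y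
  have hmy := min_le_right x y
  rw [boolSign_not]
  have hs : |boolSign (v j) * g S| ≤ 1 := by rw [abs_mul, abs_boolSign, one_mul]; exact hg S
  have hs' := abs_le.1 hs
  nlinarith [mul_nonneg (sub_nonneg.2 hmx) (sub_nonneg.2 hs'.2),
    mul_nonneg (sub_nonneg.2 hmy) (by linarith : 0 ≤ 1 + boolSign (v j) * g S)]

/-- Assouad's lemma for the distributions `biasedWeight τ v`. -/
theorem exists_average_error_ge {m n : ℕ} (hm : 1 ≤ m) {τ : ℝ} (h0 : 0 ≤ τ) (h1 : τ ≤ 1)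
    (g : (Fin n → Fin m × Bool) → Fin m → ℝ) (hg : ∀ S j, |g S j| ≤ 1) :
    ∃ v : Fin m → Bool, (1 - 2 * n * τ ^ 2 / m) / 2 ≤
      (∑ j, ∑ S, (∏ i, biasedWeight τ v (S i)) * (1 - boolSign (v j) * g S j)) / m := by
  have hm0 : (0 : ℝ) < m := by positivity
  by_contra! hcon
  set E : (Fin m → Bool) → Fin m → ℝ := fun v j =>
    ∑ S, (∏ i, biasedWeight τ v (S i)) * (1 - boolSign (v j) * g S j) with hE
  set B : ℝ := 1 - 2 * n * τ ^ 2 / m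
  have hj : ∀ j, ∑ v : Fin m → Bool, B / 2 ≤ ∑ v, E v j := by
    intro j
    -- Flipping coordinate `j` permutes the sign vectors, so each sum over `v` can be paired with
    -- its flip.
    have hflip : Function.Involutive fun v : Fin m → Bool => Function.update v j (!v j) := by
      intro v
      simp
    have e : ∑ v, E (Function.update v j (!v j)) j = ∑ v, E v j :=
      Equiv.sum_comp (hflip.toPerm _) fun v => E v j
    have : ∑ v : Fin m → Bool, B ≤ ∑ v, (E v j + E (Function.update v j (!v j)) j) := by
      refine Finset.sum_le_sum fun v _ => ?_
      simp only [hE, Function.update_self]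
      exact two_point_bound hm h0 h1 v j (fun S => g S j) fun S => hg S j
    rw [Finset.sum_add_distrib, e] at this
    rw [← Finset.sum_div]
    linarith
  have h2 : ∑ v, (∑ j, E v j) / m < ∑ v : Fin m → Bool, B / 2 :=
    Finset.sum_lt_sum_of_nonempty Finset.univ_nonempty fun v _ => hcon v
  have h3 : ∑ j : Fin m, ∑ v : Fin m → Bool, B / 2 ≤ ∑ j, ∑ v, E v j :=
    Finset.sum_le_sum fun j _ => hj j
  rw [Finset.sum_comm (f := fun j v => E v j), Finset.sum_const, Finset.card_univ,
    Fintype.card_fin, nsmul_eq_mul] at h3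
  rw [← Finset.sum_div, div_lt_iff₀ hm0] at h2
  linarith

/-! ### From finite sums to learners -/

/-- The probability measure on `Fin m × Bool` with weights `biasedWeight τ v`. -/
noncomputable def biasedMeasure {m : ℕ} (τ : ℝ) (v : Fin m → Bool) : Measure (Fin m × Bool) :=
  ∑ ω, ENNReal.ofReal (biasedWeight τ v ω) • Measure.dirac ω

theorem biasedMeasure_singleton {m : ℕ} (τ : ℝ) (v : Fin m → Bool) (ω : Fin m × Bool) :
    biasedMeasure τ v {ω} = ENNReal.ofReal (biasedWeight τ v ω) := by
  classical
  simp only [biasedMeasure, Measure.coe_finsetSum, Finset.sum_apply, Measure.smul_apply,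
    smul_eq_mul]
  rw [Finset.sum_eq_single ω]
  · simp
  · intro b _ hb
    simp [hb]
  · simp

theorem isProbabilityMeasure_biasedMeasure {m : ℕ} (hm : 1 ≤ m) {τ : ℝ} (h0 : 0 ≤ τ)
    (h1 : τ ≤ 1) (v : Fin m → Bool) : IsProbabilityMeasure (biasedMeasure τ v) := by
  constructor
  rw [biasedMeasure]
  simp only [Measure.coe_finsetSum, Finset.sum_apply, Measure.smul_apply, smul_eq_mul,
    measure_univ, mul_one]
  rw [← ENNReal.ofReal_sum_of_nonneg fun ω _ => biasedWeight_nonneg h0 h1 v ω,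
    sum_biasedWeight hm, ENNReal.ofReal_one]

theorem integral_pi_map_biasedMeasure {m n : ℕ} (hm : 1 ≤ m) {τ : ℝ} (h0 : 0 ≤ τ) (h1 : τ ≤ 1)
    (v : Fin m → Bool) {Z : Type*} [MeasurableSpace Z] (z : Fin m × Bool → Z)
    (G : (Fin n → Z) → ℝ) (hG : Measurable G) :
    ∫ S, G S ∂(Measure.pi fun _ : Fin n => (biasedMeasure τ v).map z) =
      ∑ S : Fin n → Fin m × Bool, (∏ i, biasedWeight τ v (S i)) * G fun i => z (S i) := by
  have := isProbabilityMeasure_biasedMeasure hm h0 h1 v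
  have hz : Measurable z := measurable_of_countable z
  have : IsProbabilityMeasure ((biasedMeasure τ v).map z) :=
    Measure.isProbabilityMeasure_map hz.aemeasurable
  rw [← Measure.pi_map_pi (fun _ => hz.aemeasurable),
    integral_map (measurable_of_countable _).aemeasurable hG.aestronglyMeasurable,
    integral_fintype .of_finite]
  refine Finset.sum_congr rfl fun S _ => ?_
  rw [Measure.real, Measure.pi_singleton, ENNReal.toReal_prod, smul_eq_mul]
  congr 1
  refine Finset.prod_congr rfl fun i _ => ?_
  rw [biasedMeasure_singleton, ENNReal.toReal_ofReal (biasedWeight_nonneg h0 h1 v _)]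

theorem populationRisk_map_biasedMeasure {m : ℕ} (hm : 1 ≤ m) {τ : ℝ} (h0 : 0 ≤ τ) (h1 : τ ≤ 1)
    (v : Fin m → Bool) {Θ Z : Type*} [MeasurableSpace Z] {f : Θ → Z → ℝ}
    {z : Fin m × Bool → Z} {a : Θ → Fin m → ℝ} {K : ℝ}
    (hf : ∀ θ j b, f θ (z (j, b)) = -(K * (boolSign b * a θ j)))
    (hfm : ∀ θ, Measurable (f θ)) (θ : Θ) :
    populationRisk f ((biasedMeasure τ v).map z) θ
      = -(K * (τ / m * ∑ j, boolSign (v j) * a θ j)) := by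
  have := isProbabilityMeasure_biasedMeasure hm h0 h1 v
  rw [populationRisk, integral_map (measurable_of_countable z).aemeasurable
    (hfm θ).aestronglyMeasurable, integral_fintype .of_finite, ← sum_biasedWeight_mul_sign,
    Finset.mul_sum, ← Finset.sum_neg_distrib]
  refine Finset.sum_congr rfl fun ω _ => ?_
  rw [Measure.real, biasedMeasure_singleton,
    ENNReal.toReal_ofReal (biasedWeight_nonneg h0 h1 v _), hf, smul_eq_mul]
  ring

/-- Lower bound for learners of a problem that contains `m` independent one-dimensional linear
problems of scale `K / m`, each example being informative for one of them only. -/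
theorem IsAlphaLearner.le_of_blocks {Θ Z : Type*} [MeasurableSpace Θ] [MeasurableSpace Z]
    [Countable Z] [MeasurableSingletonClass Z] {f : Θ → Z → ℝ} {α : ℝ} {n m : ℕ}
    {A : Kernel (Fin n → Z) Θ} (hA : IsAlphaLearner f α A) (hm : 1 ≤ m)
    {z : Fin m × Bool → Z} {a : Θ → Fin m → ℝ} {K : ℝ} (hK : 0 ≤ K)
    (hf : ∀ θ j b, f θ (z (j, b)) = -(K * (boolSign b * a θ j)))
    (ham : ∀ j, Measurable fun θ => a θ j) (ha : ∀ θ j, |a θ j| ≤ 1)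
    (hsol : ∀ v : Fin m → Bool, ∃ θ, ∀ j, a θ j = boolSign (v j))
    {τ : ℝ} (h0 : 0 ≤ τ) (h1 : τ ≤ 1) :
    K * (τ / 2 * (1 - 2 * n * τ ^ 2 / m)) ≤ α := by
  have hm0 : (0 : ℝ) < m := by positivity
  obtain ⟨hAm, hA⟩ := hA
  have hint : ∀ S j, Integrable (fun θ => a θ j) (A S) := fun S j =>
    .of_bound (ham j).aestronglyMeasurable 1 (.of_forall fun θ => ha θ j)
  set g : (Fin n → Fin m × Bool) → Fin m → ℝ := fun S j => ∫ θ, a θ j ∂(A fun i => z (S i))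
    with hg
  have hg1 : ∀ S j, |g S j| ≤ 1 := fun S j => by
    simpa using norm_integral_le_of_norm_le_const (μ := A fun i => z (S i))
      (f := fun θ => a θ j) (C := 1) (.of_forall fun θ => ha θ j)
  obtain ⟨v, hv⟩ := exists_average_error_ge (n := n) hm h0 h1 g hg1
  have := isProbabilityMeasure_biasedMeasure hm h0 h1 v
  have hD : IsProbabilityMeasure ((biasedMeasure τ v).map z) :=
    Measure.isProbabilityMeasure_map (measurable_of_countable z).aemeasurable
  specialize hA _ hD
  have hrisk := populationRisk_map_biasedMeasure hm h0 h1 v hf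
    fun θ => measurable_of_countable (f θ)
  have hrisk_int : ∀ S, ∫ θ, populationRisk f ((biasedMeasure τ v).map z) θ ∂(A S)
      = -(K * (τ / m * ∑ j, boolSign (v j) * ∫ θ, a θ j ∂(A S))) := by
    intro S
    simp_rw [hrisk]
    rw [integral_neg, integral_const_mul, integral_const_mul,
      integral_finsetSum _ fun j _ => (hint S j).const_mul _]
    simp_rw [integral_const_mul]
  obtain ⟨θ₀, hθ₀⟩ := hsol v
  have hinf : ⨅ θ, populationRisk f ((biasedMeasure τ v).map z) θ ≤ -(K * τ) := by
    -- Needed because `⨅` over a set unbounded below takes the default value `0` in `ℝ`.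
    have hbdd : BddBelow (Set.range fun θ => populationRisk f ((biasedMeasure τ v).map z) θ) := by
      refine ⟨-(K * τ), ?_⟩
      rintro _ ⟨θ, rfl⟩
      simp only [hrisk]
      have : ∑ j, boolSign (v j) * a θ j ≤ ∑ _j : Fin m, (1 : ℝ) :=
        Finset.sum_le_sum fun j _ => (le_abs_self _).trans <| by
          rw [abs_mul, abs_boolSign, one_mul]
          exact ha θ j
      have h2 : τ / m * ∑ j, boolSign (v j) * a θ j ≤ τ := by
        calc _ ≤ τ / m * ∑ _j : Fin m, (1 : ℝ) := by gcongr
          _ = τ := by simp [hm0.ne']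
      have := mul_le_mul_of_nonneg_left h2 hK
      linarith
    refine (ciInf_le hbdd θ₀).trans (le_of_eq ?_)
    rw [hrisk]
    simp [hθ₀, boolSign_mul_self, hm0.ne']
  rw [integral_pi_map_biasedMeasure hm h0 h1 v z _ (measurable_of_countable _)] at hA
  simp_rw [hrisk_int] at hA
  have hP1 : ∑ S : Fin n → Fin m × Bool, ∏ i, biasedWeight τ v (S i) = 1 := by
    rw [← Fintype.sum_pow, sum_biasedWeight hm, one_pow]
  have e : (∑ j, ∑ S, (∏ i, biasedWeight τ v (S i)) * (1 - boolSign (v j) * g S j))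
      = m - ∑ S, (∏ i, biasedWeight τ v (S i)) * ∑ j, boolSign (v j) * g S j := by
    rw [Finset.sum_comm]
    simp_rw [← Finset.mul_sum, Finset.sum_sub_distrib, mul_sub, Finset.sum_sub_distrib]
    rw [← Finset.sum_mul, hP1]
    simp
  rw [e] at hv
  have e2 : ∑ S, (∏ i, biasedWeight τ v (S i)) * -(K * (τ / m * ∑ j, boolSign (v j) * g S j))
      = -(K * τ / m * ∑ S, (∏ i, biasedWeight τ v (S i)) * ∑ j, boolSign (v j) * g S j) := by
    rw [Finset.mul_sum, ← Finset.sum_neg_distrib]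
    exact Finset.sum_congr rfl fun S _ => by ring
  rw [e2] at hA
  set X := ∑ S, (∏ i, biasedWeight τ v (S i)) * ∑ j, boolSign (v j) * g S j
  have h3 := mul_le_mul_of_nonneg_left hv (mul_nonneg hK h0)
  have e3 : K * τ * ((m - X) / m) = K * τ - K * τ / m * X := by field_simp
  rw [e3] at h3
  calc _ = K * τ * ((1 - 2 * n * τ ^ 2 / m) / 2) := by ring
    _ ≤ _ := h3
    _ ≤ α := by linarith

/-! ### Blocks inside the hard problem -/

theorem finite_hardData (d k : ℕ) : (hardData d k).Finite := by
  refine (Set.Finite.pi (t := fun _ : Fin d => ({0, 1, -1} : Set ℝ))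
    fun _ => Set.toFinite _).subset ?_
  rintro z ⟨hz, -⟩ i -
  simpa using hz i

/-- The vector equal to `boolSign b` on the `j`-th block of coordinates and to zero elsewhere. -/
noncomputable def blockVector {d k m : ℕ} (e : Fin m × Fin k ↪ Fin d) (ω : Fin m × Bool) :
    Fin d → ℝ :=
  fun i => if i ∈ Finset.univ.image fun t => e (ω.1, t) then boolSign ω.2 else 0

theorem block_injective {d k m : ℕ} (e : Fin m × Fin k ↪ Fin d) (j : Fin m) :
    Function.Injective fun t => e (j, t) := fun s t h => by
  simpa using e.injective h

theorem blockVector_mem {d k m : ℕ} (e : Fin m × Fin k ↪ Fin d) (ω : Fin m × Bool) :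
    blockVector e ω ∈ hardData d k := by
  have hs : boolSign ω.2 = 1 ∨ boolSign ω.2 = -1 := by
    cases ω.2 <;> simp [boolSign]
  have hs0 : boolSign ω.2 ≠ 0 := by rcases hs with h | h <;> simp [h]
  refine ⟨fun i => ?_, ?_⟩
  · unfold blockVector
    split_ifs
    · exact .inr hs
    · exact .inl rfl
  · have : {i | blockVector e ω i ≠ 0} = ↑(Finset.univ.image fun t => e (ω.1, t)) := by
      ext i
      unfold blockVector
      simp [hs0]
    rw [this, Set.ncard_coe_finset, Finset.card_image_of_injective _ (block_injective e ω.1)]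
    simp

theorem sum_mul_blockVector {d k m : ℕ} (e : Fin m × Fin k ↪ Fin d) (ω : Fin m × Bool)
    (x : Fin d → ℝ) :
    ∑ i, x i * blockVector e ω i = boolSign ω.2 * ∑ t, x (e (ω.1, t)) := by
  simp only [blockVector, mul_ite, mul_zero]
  rw [← Finset.sum_filter, Finset.filter_mem_eq_inter, Finset.univ_inter,
    Finset.sum_image fun s _ t _ h => block_injective e ω.1 h, Finset.mul_sum]
  exact Finset.sum_congr rfl fun t _ => mul_comm _ _

/-- Block averages of `θ`, rescaled by the radius `d ^ (-(1 / p))`, lie in `[-1, 1]`. The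
normalisation of the loss then leaves the scale `k ^ (-(1 - 1 / p)) * k * d ^ (-(1 / p)) = (k / d) ^
(1 / p)`. -/
theorem hardLearner_le {d n k m : ℕ} {p α τ : ℝ} (hk : 1 ≤ k) (hm : 1 ≤ m) (hmk : m * k ≤ d)
    {A : Kernel (Fin n → hardData d k) (hardParam d p)}
    (hA : IsAlphaLearner (hardLoss d k p) α A) (h0 : 0 ≤ τ) (h1 : τ ≤ 1) :
    ((k : ℝ) / d) ^ (1 / p) * (τ / 2 * (1 - 2 * n * τ ^ 2 / m)) ≤ α := by
  have hd : 0 < d := lt_of_lt_of_le (Nat.mul_pos hm hk) hmk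
  have hd0 : (0 : ℝ) < d := by exact_mod_cast hd
  have hk0 : (0 : ℝ) < k := by exact_mod_cast hk
  have : Countable (hardData d k) := (finite_hardData d k).countable
  set e : Fin m × Fin k ↪ Fin d :=
    finProdFinEquiv.toEmbedding.trans (Fin.castLEEmb hmk)
  set r : ℝ := (d : ℝ) ^ (-(1 / p)) with hr
  have hr0 : 0 < r := by positivity
  have hθ : ∀ θ : hardParam d p, ∀ i, |(θ : Fin d → ℝ) i| ≤ r := fun θ i => by
    have := mem_closedBall_zero_iff.1 θ.2
    exact (norm_le_pi_norm (θ : Fin d → ℝ) i).trans this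
  refine hA.le_of_blocks hm (z := fun ω => ⟨blockVector e ω, blockVector_mem e ω⟩)
    (a := fun θ j => (∑ t, (θ : Fin d → ℝ) (e (j, t))) / (k * r)) (by positivity)
    ?_ ?_ ?_ ?_ h0 h1
  · intro θ j b
    simp only [hardLoss, sum_mul_blockVector]
    have hkr : (k : ℝ) ^ (-(1 - 1 / p)) * (k * r) = ((k : ℝ) / d) ^ (1 / p) := by
      rw [hr, Real.rpow_neg hd0.le, Real.div_rpow hk0.le hd0.le, ← mul_assoc,
        ← Real.rpow_add_one hk0.ne', div_eq_mul_inv]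
      congr 2
      ring
    rw [← hkr]
    field_simp
  · intro j
    refine Measurable.div_const (Finset.measurable_sum _ fun t _ => ?_) _
    exact (measurable_pi_apply _).comp measurable_subtype_coe
  · intro θ j
    rw [abs_div, abs_of_pos (by positivity : 0 < k * r), div_le_one (by positivity)]
    calc _ ≤ ∑ t, |(θ : Fin d → ℝ) (e (j, t))| := Finset.abs_sum_le_sum_abs _ _
      _ ≤ ∑ _t : Fin k, r := Finset.sum_le_sum fun t _ => hθ θ _
      _ = k * r := by simp
  · intro v
    -- A vertex of the cube with the prescribed signs on the blocks; the sign elsewhere is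
    -- arbitrary.
    refine ⟨⟨fun i => r * boolSign (Function.extend e (fun x => v x.1) (fun _ => true) i), ?_⟩,
      fun j => ?_⟩
    · rw [hardParam, mem_closedBall_zero_iff, pi_norm_le_iff_of_nonneg hr0.le]
      intro i
      rw [Real.norm_eq_abs, abs_mul, abs_boolSign, mul_one, abs_of_pos hr0]
    · simp only [e.injective.extend_apply]
      simp
      field_simp

/-! ### Choice of the bias and the sparsity -/

theorem dense_lower_bound {d n : ℕ} {p α : ℝ} (hd : 1 ≤ d) (hn : 1 ≤ n)
    {A : Kernel (Fin n → hardData d d) (hardParam d p)}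
    (hA : IsAlphaLearner (hardLoss d d p) α A) : 1 / 96 / √n ≤ α := by
  have hn1 : (1 : ℝ) ≤ √n := Real.one_le_sqrt.2 (by exact_mod_cast hn)
  have hd0 : (d : ℝ) ≠ 0 := by positivity
  -- This `τ` makes `2 * n * τ ^ 2 = 1 / 2`, leaving `1 / (8 * √n) ≤ α`.
  have h := hardLearner_le (τ := 1 / (2 * √n)) hd le_rfl (one_mul d).le hA (by positivity)
    (by rw [div_le_one (by positivity)]; linarith)
  have e : 2 * (n : ℝ) * (1 / (2 * √n)) ^ 2 / (1 : ℕ) = 1 / 2 := by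
    rw [div_pow, mul_pow, Real.sq_sqrt (Nat.cast_nonneg n)]
    have : (n : ℝ) ≠ 0 := by positivity
    push_cast
    field_simp
  rw [e, div_self hd0, Real.one_rpow] at h
  refine le_trans ?_ h
  have : 0 < (√n)⁻¹ := by positivity
  rw [one_mul, div_eq_mul_inv, one_div (2 * √n), mul_inv]
  linarith

theorem sparse_lower_bound {d n : ℕ} {p α : ℝ} (hd : 1 ≤ d) (hn : 1 ≤ n) (hp : 1 ≤ p)
    (hα : 0 < α) {A : Kernel (Fin n → hardData d (hardSparsity d p α)) (hardParam d p)}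
    (hA : IsAlphaLearner (hardLoss d (hardSparsity d p α) p) α A) :
    1 / 96 * min (1 / (n : ℝ) ^ (1 / p)) ((d : ℝ) ^ (1 / 2 - 1 / p) / √n) ≤ α := by
  have hd1 : (1 : ℝ) ≤ d := by exact_mod_cast hd
  have hn1 : (1 : ℝ) ≤ n := by exact_mod_cast hn
  have hp0 : 0 < p := by linarith
  suffices 1 / (n : ℝ) ^ (1 / p) ≤ 96 * α ∨ (d : ℝ) ^ (1 / 2 - 1 / p) / √n ≤ 96 * α by
    have := min_le_iff.2 this
    linarith
  -- For large `α` the first term suffices; for small `α` the cap of the sparsity at `d` is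
  -- inactive.
  by_cases hα1 : 1 / 96 ≤ α
  · left
    have : 1 ≤ (n : ℝ) ^ (1 / p) := Real.one_le_rpow hn1 (by positivity)
    have := (div_le_one (by linarith)).2 this
    linarith
  push Not at hα1
  have hx1 : (6 * α) ^ p ≤ 1 := Real.rpow_le_one (by positivity) (by linarith) hp0.le
  set x : ℝ := (6 * α) ^ p * d with hx
  have hx0 : 0 < x := by positivity
  have hxd : ⌈x⌉₊ ≤ d := Nat.ceil_le.2 (by nlinarith)
  have hks : hardSparsity d p α = max ⌈x⌉₊ 1 := min_eq_right (max_le hxd hd)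
  generalize hardSparsity d p α = k at A hA hks
  have hk : 1 ≤ k := hks ▸ le_max_right _ _
  have hkd : k ≤ d := hks ▸ max_le hxd hd
  have hkx : x ≤ k := (Nat.le_ceil x).trans (by rw [hks]; exact_mod_cast le_max_left _ _)
  have hK : 6 * α ≤ ((k : ℝ) / d) ^ (1 / p) := by
    calc 6 * α = ((6 * α) ^ p) ^ (1 / p) := by
          rw [← Real.rpow_mul (by positivity), mul_one_div_cancel hp0.ne', Real.rpow_one]
      _ ≤ _ := by
          refine Real.rpow_le_rpow (by positivity) ?_ (by positivity)
          rwa [le_div_iff₀ (by positivity)]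
  have hm : 1 ≤ d / k := (Nat.one_le_div_iff hk).2 hkd
  -- If `m ≥ 4 * n`, full bias `τ = 1` would give `α ≥ K / 4 ≥ 3 * α / 2`, which is absurd.
  have hmn : ((d / k : ℕ) : ℝ) < 4 * n := by
    by_contra! hcon
    have hm0 : (0 : ℝ) < (d / k : ℕ) := by exact_mod_cast hm
    have h := hardLearner_le hk hm (Nat.div_mul_le_self d k) hA zero_le_one le_rfl
    have h2 : 2 * (n : ℝ) * 1 ^ 2 / (d / k : ℕ) ≤ 1 / 2 := by
      rw [div_le_iff₀ hm0]
      linarith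
    nlinarith
  -- With `k = 1` there are `m = d < 4 * n` blocks, and `τ = √d / (2 * √n)` is admissible. With `k >
  -- 1` rounding costs at most a factor `2`, so `m < 4 * n` itself bounds `α`.
  rcases le_or_gt ⌈x⌉₊ 1 with hc | hc
  · right
    rw [max_eq_right hc] at hks
    subst hks
    rw [Nat.div_one] at hmn
    have hτ1 : √d / (2 * √n) ≤ 1 := by
      rw [div_le_one (by positivity)]
      refine Real.sqrt_le_iff.2 ⟨by positivity, ?_⟩
      rw [mul_pow, Real.sq_sqrt (by positivity)]
      linarith
    have h := hardLearner_le (τ := √d / (2 * √n)) le_rfl hd (mul_one d).le hA (by positivity) hτ1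
    have e : 2 * (n : ℝ) * (√d / (2 * √n)) ^ 2 / d = 1 / 2 := by
      rw [div_pow, mul_pow, Real.sq_sqrt (by positivity), Real.sq_sqrt (by positivity)]
      field_simp
    rw [e] at h
    have e2 : (d : ℝ) ^ (1 / 2 - 1 / p) / √n
        = 8 * (((1 : ℕ) / d : ℝ) ^ (1 / p) * (√d / (2 * √n) / 2 * (1 - 1 / 2))) := by
      rw [Real.rpow_sub (by positivity), ← Real.sqrt_eq_rpow, Nat.cast_one,
        Real.div_rpow zero_le_one (by positivity), Real.one_rpow]
      field_simp
      norm_num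
    rw [e2]
    linarith
  · left
    rw [max_eq_left hc.le] at hks
    have hx2 : 1 < x := by simpa using Nat.lt_ceil.1 hc
    have hk2 : (k : ℝ) < x + 1 := hks ▸ Nat.ceil_lt_add_one hx0.le
    have hdk : d < (d / k + 1) * k := by
      rw [mul_comm]
      exact Nat.lt_mul_div_succ d hk
    have hdk' : (d : ℝ) < ((d / k : ℕ) + 1) * k := by exact_mod_cast hdk
    have hm1 : (1 : ℝ) ≤ (d / k : ℕ) := by exact_mod_cast hm
    have hk0 : (0 : ℝ) < k := by exact_mod_cast hk
    have h3 : (d : ℝ) < 16 * n * x := by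
      calc (d : ℝ) < ((d / k : ℕ) + 1) * k := hdk'
        _ ≤ (8 * n) * k := by gcongr; linarith
        _ ≤ (8 * n) * (2 * x) := by gcongr; linarith
        _ = _ := by ring
    -- The constant is `96 = 16 * 6`: since `p ≥ 1`, the factor `16` of `h3` is absorbed into `16 ^
    -- p`.
    have h4 : 1 / (n : ℝ) ≤ (96 * α) ^ p := by
      have h16 : (16 : ℝ) ≤ 16 ^ p := Real.self_le_rpow_of_one_le (by norm_num) hp
      have e : (96 * α) ^ p = 16 ^ p * (6 * α) ^ p := by
        rw [← Real.mul_rpow (by norm_num) (by positivity)]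
        congr 1
        ring
      have h5 : 1 < 16 * n * (6 * α) ^ p := by
        rw [hx, ← mul_assoc] at h3
        exact (lt_mul_iff_one_lt_left (by positivity)).1 h3
      rw [e, div_le_iff₀ (by positivity)]
      have : 0 ≤ (6 * α) ^ p * n := by positivity
      nlinarith
    calc 1 / (n : ℝ) ^ (1 / p) = (1 / (n : ℝ)) ^ (1 / p) := by
          rw [Real.div_rpow zero_le_one (by positivity), Real.one_rpow]
      _ ≤ ((96 * α) ^ p) ^ (1 / p) := Real.rpow_le_rpow (by positivity) h4 (by positivity)
      _ = 96 * α := by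
          rw [← Real.rpow_mul (by positivity), mul_one_div_cancel hp0.ne', Real.rpow_one]

theorem mainTheorem11 :
    ∃ c : ℝ, 0 < c ∧
      ∀ (d n : ℕ) (p α : ℝ), 1 ≤ d → 1 ≤ n → 1 ≤ p → 0 < α →
        (p ≤ 2 →
          (∃ A : ProbabilityTheory.Kernel (Fin n → hardData d d) (hardParam d p),
            IsAlphaLearner (hardLoss d d p) α A) →
          c / Real.sqrt n ≤ α) ∧
        (2 ≤ p →
          (∃ A : ProbabilityTheory.Kernel
              (Fin n → hardData d (hardSparsity d p α)) (hardParam d p),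
            IsAlphaLearner (hardLoss d (hardSparsity d p α) p) α A) →
          c * min (1 / (n : ℝ) ^ (1 / p)) ((d : ℝ) ^ (1 / 2 - 1 / p) / Real.sqrt n) ≤ α) := by
  refine ⟨1 / 96, by norm_num, fun d n p α hd hn hp hα =>
    ⟨fun _ ⟨A, hA⟩ => ?_, fun _ ⟨A, hA⟩ => ?_⟩⟩
  · exact dense_lower_bound hd hn hA
  · exact sparse_lower_bound hd hn hp hα hA
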